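/- Let $\mathbb{D}=\{z\in\mathbb{C}:|z|<1\}$, let $\sigma>1$ be real, and let $m\ge 0$ be an integer with $m<(\sigma-1)/2$. For $k=0,1,2,\dots$ and $z\in\mathbb{D}$ put $$\Phi_k^{\sigma,m}(z)=\sqrt{\frac{(\sigma-2m-1)\,\Gamma(\sigma-m)\,k!}{\pi\, m!\,\Gamma(\sigma-2m+k)}}\;\frac{(-1)^k\,\bar z^{\,m-k}}{(1-z\bar z)^m}\;P_k^{(m-k,\,\sigma-2m-1)}(1-2z\bar z),$$ where $P_k^{(\alpha,\beta)}$ denotes the Jacobi polynomial (for $k>m$ the singularity at $z=0$ is removable and $\Phi_k^{\sigma,m}(0)=0$). Let $\{\psi_k\}_{k\ge 0}$ be an orthonormal system in a complex Hilbert space $\mathcal{H}$, whose scalar product $\langle\cdot,\cdot\rangle$ is linear in the first and antilinear in the second argument. For $z\in\mathbb{D}$ define the coherent state $$|z,\sigma,m\rangle=\mathcal{N}(z)^{-1/2}\sum_{k=0}^{\infty}\overline{\Phi_k^{\sigma,m}(z)}\,\psi_k,\qquad \mathcal{N}(z)=\sum_{k=0}^{\infty}|\Phi_k^{\sigma,m}(z)|^2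 .$$ Then for every $z\in\mathbb{D}$ both series converge, $\mathcal{N}(z)>0$, and $|z,\sigma,m\rangle$ is a unit vector. Moreover, for all $z,w\in\mathbb{D}$, the overlap $\langle w,\sigma,m|z,\sigma,m\rangle$, that is, the scalar product $\langle\,|w,\sigma,m\rangle,|z,\sigma,m\rangle\,\rangle$, equals $$\frac{(\sigma-2m-1)\,\Gamma(\sigma-m)\,\big(\mathcal{N}(z)\mathcal{N}(w)\big)^{-1/2}}{\pi\, m!\,(-1)^m\,\Gamma(\sigma-2m)\,(1-z\bar w)^{\sigma}}\;R(z,w)^m\;{}_2F_1\!\left(-m,\ \sigma-m;\ \sigma-2m;\ \frac{1}{R(z,w)}\right),$$ where $$R(z,w)=\frac{(1-z\bar w)(1-\bar z w)}{(1-z\bar z)(1-w\bar w)}=\cosh^2 d(z,w)$$ for the Bergman distance $d$ on $\mathbb{D}$, the power $(1-z\bar w)^{\sigma}$ is the principal one, and ${}_2F_1$ is the (terminating) Gauss hypergeometric sum. -/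

import Mathlib

open scoped ComplexConjugate

noncomputable section

namespace DiskCoherentState

/-- The Jacobi polynomial `P_n^{(α, β)}(x)` for arbitrary real parameters, through
`P_n^{(α, β)}(x) = ∑ₛ C(n + α, n - s) C(n + β, s) ((x - 1) / 2) ^ s ((x + 1) / 2) ^ (n - s)`
with generalized binomial coefficients. It is polynomial in `α` and `β`, so it also covers the
negative integer values of `α` needed below. -/
def jacobiP (n : ℕ) (α β x : ℝ) : ℝ :=
  ∑ s ∈ Finset.range (n + 1),
    Ring.choose ((n : ℝ) + α) (n - s) * Ring.choose ((n : ℝ) + β) s *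
      ((x - 1) / 2) ^ s * ((x + 1) / 2) ^ (n - s)

/-- The basis function `Φ_k^{σ, m}` of the `m`-th generalized Bergman space of the unit disk.
The exponent `m - k` is an integer. For `k > m` the Jacobi factor is a multiple of
`|z| ^ (2 (k - m))`, so the singularity at `z = 0` is removable with value `0`, and this is the
value that the convention `0 ^ j = 0` for integers `j ≠ 0` gives. -/
def basisFun (σ : ℝ) (m k : ℕ) (z : ℂ) : ℂ :=
  (Real.sqrt ((σ - 2 * m - 1) * Real.Gamma (σ - m) * (k.factorial : ℝ) /
      (Real.pi * (m.factorial : ℝ) * Real.Gamma (σ - 2 * m + k))) : ℂ) *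
    ((-1) ^ k * conj z ^ ((m : ℤ) - (k : ℤ)) / (1 - z * conj z) ^ m) *
    (jacobiP k ((m : ℝ) - k) (σ - 2 * m - 1) (1 - 2 * ‖z‖ ^ 2) : ℂ)

/-- The normalization factor `𝒩_{σ, m}(z) = ∑ₖ |Φ_k^{σ, m}(z)|²`. -/
def normFactor (σ : ℝ) (m : ℕ) (z : ℂ) : ℝ :=
  ∑' k : ℕ, ‖basisFun σ m k z‖ ^ 2

/-- The coherent state
`|z, σ, m⟩ = 𝒩_{σ, m}(z) ^ (-1/2) ∑ₖ conj (Φ_k^{σ, m}(z)) |ψ_k⟩` built on the vectors `ψ_k`. -/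
def coherentState {H : Type*} [NormedAddCommGroup H] [InnerProductSpace ℂ H]
    (ψ : ℕ → H) (σ : ℝ) (m : ℕ) (z : ℂ) : H :=
  ((normFactor σ m z ^ (-(1 / 2) : ℝ) : ℝ) : ℂ) • ∑' k : ℕ, conj (basisFun σ m k z) • ψ k

/-- `cosh² d(z, w)` for the Bergman distance `d` of the unit disk. -/
def bergmanCoshSq (z w : ℂ) : ℂ :=
  (1 - z * conj w) * (1 - conj z * w) / ((1 - z * conj z) * (1 - w * conj w))

end DiskCoherentState

end

namespace DiskCoherentState

open Finset Polynomial

/-! Put c = σ - 2m. Up to its constant and the power of 1 - |z|², `basisFun` is a polynomial J_k(z,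
z̄) (`jacobiFactor`, `basisFun_eq`), and the claim amounts to summing k!/(c)_k J_k(z, z') J_k(y, w)
over k, with four independent variables (`hasSum_jacobiFactor`).

J_k(z, z') is the coefficient of s^k in (z' - s)^m (1 - zs)^(-(c+m)) (`jacobiFactor_eq`). In the
other factor the weight k!/(c)_k leaves a combination of C(k, j) y^(k-j), j ≤ m
(`factorial_div_mul_jacobiFactor`), that is, of divided derivatives of y^k. So the sum over k is a
differential operator of order at most m applied to (z' - y)^m (1 - zy)^(-(c+m)), and Leibniz' rule
gives a finite double sum.

That double sum and the hypergeometric sum are two expansions of one number: the functional X^n ↦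
(c+n)_m evaluated at the m-th power of a linear polynomial (`risingMoment_trinomial_left`,
`risingMoment_trinomial_right`).

At z = w the linear polynomial is a multiple of X - 1, and the m-th difference of (c+n)_m is m! ≠ 0,
so the kernel does not vanish and 𝒩 > 0. Orthonormality turns overlaps into kernel values. -/

/-! ### Finite differences of rising factorials -/

/-- The linear functional on polynomials that sends `X ^ n` to `(c + n)(c + n + 1)⋯(c + n + m - 1)`. -/
noncomputable def risingMoment (c : ℂ) (m : ℕ) : ℂ[X] →ₗ[ℂ] ℂ :=
  Polynomial.lsum fun n => (ascPochhammer ℂ m).eval (c + n) • LinearMap.id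

theorem risingMoment_X_pow (c : ℂ) (m n : ℕ) :
    risingMoment c m (X ^ n) = (ascPochhammer ℂ m).eval (c + n) := by
  rw [← monomial_one_right_eq_X_pow, risingMoment, lsum_apply, sum_monomial_index] <;> simp

theorem risingMoment_C_mul (c x : ℂ) (m : ℕ) (P : ℂ[X]) :
    risingMoment c m (C x * P) = x * risingMoment c m P := by
  rw [← smul_eq_C_mul, map_smul, smul_eq_mul]

theorem ascPochhammer_succ_eval_left (c : ℂ) (n : ℕ) :
    (ascPochhammer ℂ (n + 1)).eval c = c * (ascPochhammer ℂ n).eval (c + 1) := by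
  rw [ascPochhammer_succ_left]; simp

theorem ascPochhammer_eval_add (c : ℂ) (m n : ℕ) :
    (ascPochhammer ℂ (m + n)).eval c =
      (ascPochhammer ℂ m).eval c * (ascPochhammer ℂ n).eval (c + m) := by
  rw [← ascPochhammer_mul]; simp

/-- The functional `risingMoment` takes finite differences. -/
theorem risingMoment_sub_one_pow_mul (c : ℂ) (m l : ℕ) : ∀ i : ℕ,
    risingMoment c m ((X - 1) ^ l * X ^ i) =
      m.descFactorial l * (ascPochhammer ℂ (m - l)).eval (c + i + l) := by
  induction l with
  | zero => intro i; simp [risingMoment_X_pow]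
  | succ l ih =>
    intro i
    have h : ((X - 1) ^ (l + 1) * X ^ i : ℂ[X]) =
        (X - 1) ^ l * X ^ (i + 1) - (X - 1) ^ l * X ^ i := by ring
    rw [h, map_sub, ih, ih, Nat.descFactorial_succ]
    rcases Nat.lt_or_ge l m with hl | hl
    · obtain ⟨d, rfl⟩ := Nat.exists_eq_add_of_lt hl
      rw [show l + d + 1 - l = d + 1 by omega, show l + d + 1 - (l + 1) = d by omega,
        ascPochhammer_succ_eval_left (c + i + l), ascPochhammer_succ_eval]
      push_cast
      rw [show c + (i + 1) + l = c + i + l + 1 by ring, show c + i + (l + 1) = c + i + l + 1 by ring]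
      ring
    · simp [Nat.sub_eq_zero_of_le hl]

theorem risingMoment_trinomial_left (c x y u : ℂ) (m : ℕ) :
    risingMoment c m ((C (-(x - y)) * X + C (x - u)) ^ m) =
      ∑ n ∈ range (m + 1), (-1) ^ n * m.choose n * (ascPochhammer ℂ m).eval (c + n) *
        (x - y) ^ n * (x - u) ^ (m - n) := by
  rw [add_pow, map_sum]
  refine sum_congr rfl fun n _ => ?_
  rw [mul_pow, ← C_pow, ← C_pow, ← C_eq_natCast,
    show C ((-(x - y)) ^ n) * X ^ n * C ((x - u) ^ (m - n)) * C (m.choose n : ℂ) =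
      C ((-(x - y)) ^ n * (x - u) ^ (m - n) * m.choose n) * X ^ n by simp only [C_mul]; ring,
    risingMoment_C_mul, risingMoment_X_pow, neg_pow (x - y)]
  ring

/-- The linear polynomial is -(x(X - 1) - yX + u). Expanding in these three terms leaves products (X
- 1)^t X^(j-t), on which the functional is an iterated difference. -/
theorem risingMoment_trinomial_right (c x y u : ℂ) (m : ℕ) :
    risingMoment c m ((C (-(x - y)) * X + C (x - u)) ^ m) =
      ∑ j ∈ range (m + 1), ∑ t ∈ range (j + 1), (-1) ^ m * m.choose j * j.choose t *
        (m.descFactorial t * (ascPochhammer ℂ (m - t)).eval (c + j)) *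
        x ^ t * (-y) ^ (j - t) * u ^ (m - j) := by
  have h : (C (-(x - y)) * X + C (x - u) : ℂ[X]) =
      C (-1) * ((C x * (X - 1) + C (-y) * X) + C u) := by
    simp only [C_neg, C_sub, C_1]; ring
  rw [h, mul_pow, ← C_pow, risingMoment_C_mul, add_pow, map_sum, mul_sum]
  refine sum_congr rfl fun j _ => ?_
  rw [add_pow, sum_mul, sum_mul, map_sum, mul_sum]
  refine sum_congr rfl fun t ht => ?_
  rw [mul_pow, mul_pow, ← C_pow, ← C_pow, ← C_pow, ← C_eq_natCast, ← C_eq_natCast,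
    show C (x ^ t) * (X - 1) ^ t * (C ((-y) ^ (j - t)) * X ^ (j - t)) * C (j.choose t : ℂ) *
        C (u ^ (m - j)) * C (m.choose j : ℂ) =
      C (x ^ t * (-y) ^ (j - t) * j.choose t * u ^ (m - j) * m.choose j) *
        ((X - 1) ^ t * X ^ (j - t)) by simp only [C_mul]; ring,
    risingMoment_C_mul, risingMoment_sub_one_pow_mul,
    show c + ((j - t : ℕ) : ℂ) + t = c + j by
      rw [Nat.cast_sub (Nat.lt_succ_iff.mp (mem_range.mp ht))]; ring]
  ring

/-! ### Negative binomial series and their divided derivatives -/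

theorem factorial_mul_multichoose (a : ℂ) (n : ℕ) :
    n.factorial * Ring.multichoose a n = (ascPochhammer ℂ n).eval a := by
  rw [← nsmul_eq_mul, Ring.factorial_nsmul_multichoose_eq_ascPochhammer,
    Polynomial.ascPochhammer_smeval_eq_eval]

theorem hasSum_multichoose_mul_pow (a : ℂ) {x : ℂ} (hx : ‖x‖ < 1) :
    HasSum (fun n : ℕ => Ring.multichoose a n * x ^ n) ((1 - x) ^ (-a)) := by
  have h := (Complex.one_div_one_sub_cpow_hasFPowerSeriesOnBall_zero a).hasSum (y := x)
    (by simpa [enorm_eq_nnnorm, ← NNReal.coe_lt_one] using hx)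
  simpa [Complex.cpow_neg, Ring.multichoose_eq, mul_comm] using h

theorem multichoose_add_mul_choose (a : ℂ) (p i : ℕ) :
    Ring.multichoose a (p + i) * (p + i).choose i =
      Ring.multichoose a i * Ring.multichoose (a + i) p := by
  have hp : (p.factorial : ℂ) ≠ 0 := by exact_mod_cast p.factorial_ne_zero
  have hi : (i.factorial : ℂ) ≠ 0 := by exact_mod_cast i.factorial_ne_zero
  apply mul_left_cancel₀ (mul_ne_zero hp hi)
  have h1 := factorial_mul_multichoose a (p + i)
  rw [add_comm p i, ascPochhammer_eval_add, ← factorial_mul_multichoose,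
    ← factorial_mul_multichoose, add_comm i p, ← Nat.add_choose_mul_factorial_mul_factorial] at h1
  push_cast [Nat.choose_symm_add] at h1
  linear_combination h1

/-- This is the i-th divided derivative in y of the series of (1 - zy)^(-a). -/
theorem hasSum_multichoose_mul_choose (a : ℂ) (i : ℕ) {z y : ℂ} (h : ‖z * y‖ < 1) :
    HasSum (fun n : ℕ => Ring.multichoose a n * z ^ n * (n.choose i * y ^ (n - i)))
      (Ring.multichoose a i * z ^ i * (1 - z * y) ^ (-(a + i))) := by
  rw [← (add_left_injective i).hasSum_iff]
  · convert! (hasSum_multichoose_mul_pow (a + i) h).mul_left (Ring.multichoose a i * z ^ i) using 1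
    ext p
    simp only [Function.comp_apply, Nat.add_sub_cancel]
    rw [mul_pow, pow_add]
    linear_combination z ^ p * z ^ i * y ^ p * multichoose_add_mul_choose a p i
  · intro n hn
    have : n < i := by
      by_contra hc
      exact hn ⟨n - i, by simp; omega⟩
    simp [Nat.choose_eq_zero_of_lt this]

/-- Leibniz' rule for the j-th divided derivative of y^l (1 - zy)^(-a); on coefficients it is
Vandermonde's identity for C(l + n, j). -/
theorem hasSum_multichoose_shift (a : ℂ) (l j : ℕ) {z y : ℂ} (h : ‖z * y‖ < 1) :
    HasSum (fun k : ℕ => (if l ≤ k then Ring.multichoose a (k - l) * z ^ (k - l) else 0) *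
        (k.choose j * y ^ (k - j)))
      (∑ t ∈ range (j + 1), l.choose t * y ^ (l - t) *
        (Ring.multichoose a (j - t) * z ^ (j - t) * (1 - z * y) ^ (-(a + (j - t : ℕ))))) := by
  rw [← (add_left_injective l).hasSum_iff]
  · have h1 := hasSum_sum (s := range (j + 1)) fun t _ =>
      (hasSum_multichoose_mul_choose a (j - t) h).mul_left (l.choose t * y ^ (l - t))
    convert! h1 using 1
    funext n
    simp only [Function.comp_apply, le_add_iff_nonneg_left, zero_le, if_true,
      Nat.add_sub_cancel]
    rw [add_comm n l, Nat.add_choose_eq, Finset.Nat.sum_antidiagonal_eq_sum_range_succ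
      (fun i k => l.choose i * n.choose k)]
    push_cast
    rw [sum_mul, mul_sum]
    refine sum_congr rfl fun t ht => ?_
    by_cases h1 : t ≤ l
    · by_cases h2 : j - t ≤ n
      · have h3 : t ≤ j := Nat.lt_succ_iff.mp (mem_range.mp ht)
        rw [show l + n - j = (l - t) + (n - (j - t)) by omega, pow_add]
        ring
      · simp [Nat.choose_eq_zero_of_lt (not_le.mp h2)]
    · simp [Nat.choose_eq_zero_of_lt (not_le.mp h1)]
  · intro n hn
    have : ¬ l ≤ n := fun hc => hn ⟨n - l, by simp; omega⟩
    simp [this]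

/-! ### Two expansions of the Jacobi factor -/

/-- The polynomial part of `basisFun`, with `z` and its conjugate as independent variables. -/
noncomputable def jacobiFactor (c : ℂ) (m k : ℕ) (z z' : ℂ) : ℂ :=
  ∑ j ∈ range (k + 1), m.choose j * Ring.multichoose (c + j) (k - j) *
    (-(1 - z * z')) ^ j * z' ^ (m - j) * z ^ (k - j)

/-- Chu–Vandermonde: the multichoose term is C(c + N - 1, N - i), whose upper entry does not depend
on i. -/
theorem sum_choose_mul_multichoose (c : ℂ) (d N : ℕ) :
    ∑ i ∈ range (N + 1), d.choose i * Ring.multichoose (c + i) (N - i) =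
      Ring.multichoose (c + d) N := by
  rw [Ring.multichoose_eq, show c + d + N - 1 = d + (c + N - 1) by ring,
    Ring.add_choose_eq N (Commute.all _ _), Finset.Nat.sum_antidiagonal_eq_sum_range_succ
      (fun i k => Ring.choose (d : ℂ) i * Ring.choose (c + N - 1) k)]
  refine sum_congr rfl fun i hi => ?_
  rw [Ring.choose_natCast, Ring.multichoose_eq,
    Nat.cast_sub (Nat.lt_succ_iff.mp (mem_range.mp hi)), show c + i + (N - i) - 1 = c + N - 1 by ring]

theorem jacobiFactor_eq (c : ℂ) (m k : ℕ) (z z' : ℂ) :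
    jacobiFactor c m k z z' =
      ∑ l ∈ range (k + 1), m.choose l * (-1) ^ l * z' ^ (m - l) *
        (Ring.multichoose (c + m) (k - l) * z ^ (k - l)) := by
  have h : ∀ j ∈ range (k + 1), m.choose j * Ring.multichoose (c + j) (k - j) *
      (-(1 - z * z')) ^ j * z' ^ (m - j) * z ^ (k - j) =
      ∑ l ∈ range (j + 1), m.choose j * Ring.multichoose (c + j) (k - j) *
        ((-1) ^ l * (z * z') ^ (j - l) * j.choose l) * z' ^ (m - j) * z ^ (k - j) := by
    intro j _
    rw [show -(1 - z * z') = -1 + z * z' by ring, add_pow, mul_sum, sum_mul, sum_mul]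
  rw [jacobiFactor, sum_congr rfl h, Finset.sum_comm' (t' := range (k + 1))
    (s' := fun l => Ico l (k + 1)) (by intro x y; simp only [mem_range, mem_Ico]; omega)]
  refine sum_congr rfl fun l hl => ?_
  have hl : l ≤ k := Nat.lt_succ_iff.mp (mem_range.mp hl)
  by_cases hlm : l ≤ m
  · rw [sum_Ico_eq_sum_range, show k + 1 - l = k - l + 1 by omega,
      show c + m = c + l + ((m - l : ℕ) : ℂ) by rw [Nat.cast_sub hlm]; ring,
      ← sum_choose_mul_multichoose, sum_mul, mul_sum]
    refine sum_congr rfl fun i hi => ?_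
    have hi : i ≤ k - l := Nat.lt_succ_iff.mp (mem_range.mp hi)
    rcases Nat.lt_or_ge (m - l) i with him | him
    · simp [Nat.choose_eq_zero_of_lt him, Nat.choose_eq_zero_of_lt (show m < l + i by omega)]
    · have h1 : (m.choose (l + i) * (l + i).choose l : ℂ) = m.choose l * (m - l).choose i := by
        have := Nat.choose_mul (n := m) (k := l + i) (s := l) (by omega)
        rw [Nat.add_sub_cancel_left] at this
        exact_mod_cast this
      rw [show l + i - l = i by omega, show k - l = (k - (l + i)) + i by omega,
        show m - l = (m - (l + i)) + i by omega, pow_add, pow_add, mul_pow,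
        show (k - (l + i)) + i - i = k - (l + i) by omega,
        show (m - (l + i)) + i = m - l by omega]
      push_cast
      rw [add_assoc c]
      linear_combination Ring.multichoose (c + (l + i)) (k - (l + i)) * (-1) ^ l * z ^ i * z' ^ i *
        z' ^ (m - (l + i)) * z ^ (k - (l + i)) * h1
  · rw [Nat.choose_eq_zero_of_lt (not_le.mp hlm)]
    simp only [Nat.cast_zero, zero_mul]
    refine sum_eq_zero fun j hj => ?_
    rw [Nat.choose_eq_zero_of_lt (lt_of_lt_of_le (not_le.mp hlm) (mem_Ico.mp hj).1)]
    simp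

theorem sum_range_congr_of_eq_zero {f : ℕ → ℂ} {k m : ℕ} (hk : ∀ j, k < j → f j = 0)
    (hm : ∀ j, m < j → f j = 0) :
    ∑ j ∈ range (k + 1), f j = ∑ j ∈ range (m + 1), f j := by
  rcases le_total k m with h | h
  · exact sum_subset (range_subset_range.mpr (by omega)) fun j _ hj =>
      hk j (by simpa using hj)
  · exact (sum_subset (range_subset_range.mpr (by omega)) fun j _ hj =>
      hm j (by simpa using hj)).symm

theorem jacobiFactor_eq_sum_ite (c : ℂ) (m k : ℕ) (z z' : ℂ) :
    jacobiFactor c m k z z' =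
      ∑ l ∈ range (m + 1), m.choose l * (-1) ^ l * z' ^ (m - l) *
        (if l ≤ k then Ring.multichoose (c + m) (k - l) * z ^ (k - l) else 0) := by
  rw [jacobiFactor_eq, ← sum_range_congr_of_eq_zero (k := k) (m := m)]
  · refine sum_congr rfl fun l hl => ?_
    rw [if_pos (Nat.lt_succ_iff.mp (mem_range.mp hl))]
  · intro j hj
    simp [not_le.mpr hj]
  · intro j hj
    simp [Nat.choose_eq_zero_of_lt hj]

theorem factorial_div_mul_jacobiFactor {c : ℂ} (hc : ∀ n, (ascPochhammer ℂ n).eval c ≠ 0)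
    (m k : ℕ) (y w : ℂ) :
    k.factorial / (ascPochhammer ℂ k).eval c * jacobiFactor c m k y w =
      ∑ j ∈ range (m + 1), m.choose j * (j.factorial / (ascPochhammer ℂ j).eval c) *
        (-(1 - y * w)) ^ j * w ^ (m - j) * (k.choose j * y ^ (k - j)) := by
  rw [jacobiFactor, mul_sum, ← sum_range_congr_of_eq_zero (k := k) (m := m)]
  · refine sum_congr rfl fun j hj => ?_
    have hj : j ≤ k := Nat.lt_succ_iff.mp (mem_range.mp hj)
    have h1 : k.factorial / (ascPochhammer ℂ k).eval c * Ring.multichoose (c + j) (k - j) =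
        j.factorial / (ascPochhammer ℂ j).eval c * k.choose j := by
      have hk := hc k
      have h2 := ascPochhammer_eval_add c j (k - j)
      rw [Nat.add_sub_cancel' hj, ← factorial_mul_multichoose (c + j)] at h2
      rw [div_mul_eq_mul_div, div_mul_eq_mul_div, div_eq_div_iff hk (hc j), h2,
        ← Nat.choose_mul_factorial_mul_factorial hj]
      push_cast
      ring
    linear_combination m.choose j * (-(1 - y * w)) ^ j * w ^ (m - j) * y ^ (k - j) * h1
  · intro j hj
    simp [Nat.choose_eq_zero_of_lt hj]
  · intro j hj
    simp [Nat.choose_eq_zero_of_lt hj]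

/-! ### Summation over k -/

theorem hasSum_jacobiFactor_mul {c : ℂ} (hc : ∀ n, (ascPochhammer ℂ n).eval c ≠ 0) (m : ℕ)
    {z y : ℂ} (z' w : ℂ) (h : ‖z * y‖ < 1) :
    HasSum (fun k : ℕ => k.factorial / (ascPochhammer ℂ k).eval c *
        jacobiFactor c m k z z' * jacobiFactor c m k y w)
      (∑ j ∈ range (m + 1), ∑ l ∈ range (m + 1),
        (m.choose j * (j.factorial / (ascPochhammer ℂ j).eval c) *
          (-(1 - y * w)) ^ j * w ^ (m - j)) * (m.choose l * (-1) ^ l * z' ^ (m - l)) *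
        ∑ t ∈ range (j + 1), l.choose t * y ^ (l - t) * (Ring.multichoose (c + m) (j - t) *
          z ^ (j - t) * (1 - z * y) ^ (-(c + m + (j - t : ℕ))))) := by
  have h1 := hasSum_sum (s := range (m + 1)) fun j _ => hasSum_sum (s := range (m + 1)) fun l _ =>
    (hasSum_multichoose_shift (c + m) l j h).mul_left
      ((m.choose j * (j.factorial / (ascPochhammer ℂ j).eval c) *
          (-(1 - y * w)) ^ j * w ^ (m - j)) * (m.choose l * (-1) ^ l * z' ^ (m - l)))
  convert! h1 using 1
  funext k
  rw [mul_right_comm, factorial_div_mul_jacobiFactor hc, jacobiFactor_eq_sum_ite, sum_mul_sum]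
  refine sum_congr rfl fun j _ => sum_congr rfl fun l _ => ?_
  ring

/-- Both sides are the t-th divided derivative of (z' - y)^m in y. -/
theorem sum_choose_mul_choose_mul_pow (m t : ℕ) (z' y : ℂ) :
    ∑ l ∈ range (m + 1), (m.choose l * (-1) ^ l * z' ^ (m - l)) * (l.choose t * y ^ (l - t)) =
      m.choose t * (-1) ^ t * (z' - y) ^ (m - t) := by
  rcases Nat.lt_or_ge m t with h | h
  · rw [Nat.choose_eq_zero_of_lt h]
    simp only [Nat.cast_zero, zero_mul]
    refine sum_eq_zero fun l hl => ?_
    rw [Nat.choose_eq_zero_of_lt (show l < t by have := mem_range.mp hl; omega)]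
    simp
  · rw [← sum_subset (s₁ := Ico t (m + 1)), sum_Ico_eq_sum_range,
      show z' - y = -y + z' by ring, add_pow, mul_sum, show m + 1 - t = m - t + 1 by omega]
    · refine sum_congr rfl fun i hi => ?_
      have h1 : (m.choose (t + i) * (t + i).choose t : ℂ) = m.choose t * (m - t).choose i := by
        have := Nat.choose_mul (n := m) (k := t + i) (s := t) (by omega)
        rw [Nat.add_sub_cancel_left] at this
        exact_mod_cast this
      rw [Nat.add_sub_cancel_left, neg_pow y, pow_add, show m - (t + i) = m - t - i by omega]
      linear_combination (-1) ^ t * (-1) ^ i * z' ^ (m - t - i) * y ^ i * h1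
    · intro l hl
      exact mem_range.mpr (mem_Ico.mp hl).2
    · intro l hl hl'
      rw [Nat.choose_eq_zero_of_lt (show l < t by simp at hl hl'; omega)]
      simp

/-- The reproducing kernel in terms of independent variables. -/
theorem hasSum_jacobiFactor {c : ℂ} (hc : ∀ n, (ascPochhammer ℂ n).eval c ≠ 0) (m : ℕ)
    {z y : ℂ} (z' w : ℂ) (h : ‖z * y‖ < 1) :
    HasSum (fun k : ℕ => k.factorial / (ascPochhammer ℂ k).eval c *
        jacobiFactor c m k z z' * jacobiFactor c m k y w)
      ((1 - z * y) ^ (-(c + 2 * m)) * (-1) ^ m / (ascPochhammer ℂ m).eval c *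
        ∑ n ∈ range (m + 1), (-1) ^ n * m.choose n * (ascPochhammer ℂ m).eval (c + n) *
          ((1 - z * z') * (1 - w * y)) ^ n * ((1 - z * y) * (1 - z' * w)) ^ (m - n)) := by
  have hp : 1 - z * y ≠ 0 := by
    intro h0
    rw [sub_eq_zero] at h0
    rw [← h0] at h
    simp at h
  convert! hasSum_jacobiFactor_mul hc m z' w h using 1
  set b := 1 - w * y with hb
  set p := 1 - z * y with hpd
  set e := z' - y with he
  -- These identities fix the trinomial variables x = bp, y = ebz, u = ewp, so that x - y and x - u
  -- are the two products in the target sum.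
  have hX : (1 - z * z') * b = b * p - e * b * z := by rw [hb, hpd, he]; ring
  have hZ : p * (1 - z' * w) = b * p - e * w * p := by rw [hb, hpd, he]; ring
  rw [hX, hZ, ← risingMoment_trinomial_left, risingMoment_trinomial_right, mul_sum]
  refine sum_congr rfl fun j hj => ?_
  have hj : j ≤ m := Nat.lt_succ_iff.mp (mem_range.mp hj)
  have h1 : ∀ l ∈ range (m + 1), (m.choose j * (j.factorial / (ascPochhammer ℂ j).eval c) *
          (-(1 - y * w)) ^ j * w ^ (m - j)) * (m.choose l * (-1) ^ l * z' ^ (m - l)) *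
        ∑ t ∈ range (j + 1), l.choose t * y ^ (l - t) * (Ring.multichoose (c + m) (j - t) *
          z ^ (j - t) * p ^ (-(c + m + (j - t : ℕ)))) =
      ∑ t ∈ range (j + 1), (m.choose j * (j.factorial / (ascPochhammer ℂ j).eval c) *
          (-b) ^ j * w ^ (m - j)) * (Ring.multichoose (c + m) (j - t) *
          z ^ (j - t) * p ^ (-(c + m + (j - t : ℕ)))) *
          ((m.choose l * (-1) ^ l * z' ^ (m - l)) * (l.choose t * y ^ (l - t))) := by
    intro l _
    rw [mul_sum]
    refine sum_congr rfl fun t _ => ?_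
    rw [hb, mul_comm y w]
    ring
  rw [sum_congr rfl h1, sum_comm, mul_sum]
  refine sum_congr rfl fun t ht => ?_
  have ht : t ≤ j := Nat.lt_succ_iff.mp (mem_range.mp ht)
  obtain ⟨i, rfl⟩ := Nat.exists_eq_add_of_le ht
  obtain ⟨d, rfl⟩ := Nat.exists_eq_add_of_le hj
  rw [← mul_sum, sum_choose_mul_choose_mul_pow, ← he]
  simp only [Nat.add_sub_cancel_left, show t + i + d - t = i + d by omega]
  have hcp : p ^ (-(c + ((t + i + d : ℕ) : ℂ) + i)) =
      p ^ (-(c + 2 * ((t + i + d : ℕ) : ℂ))) * p ^ (t + d) := by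
    rw [← Complex.cpow_natCast, ← Complex.cpow_add _ _ hp]
    congr 1
    push_cast
    ring
  -- With m = t + i + d, this comes from splitting (c)_(m+i) both after t + i and after m factors.
  have hcoef : (t + i).factorial / (ascPochhammer ℂ (t + i)).eval c *
      Ring.multichoose (c + ((t + i + d : ℕ) : ℂ)) i * (t + i + d).choose t =
      (t + i).choose t * ((t + i + d).descFactorial t *
        (ascPochhammer ℂ (i + d)).eval (c + ((t + i : ℕ) : ℂ))) /
        (ascPochhammer ℂ (t + i + d)).eval c := by
    have h2 := ascPochhammer_eval_add c (t + i) (i + d)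
    have h3 := ascPochhammer_eval_add c (t + i + d) i
    rw [show t + i + d + i = t + i + (i + d) by ring, h2,
      ← factorial_mul_multichoose (c + ((t + i + d : ℕ) : ℂ))] at h3
    rw [div_mul_eq_mul_div, div_mul_eq_mul_div, div_eq_div_iff (hc _) (hc _),
      Nat.descFactorial_eq_factorial_mul_choose, ← Nat.add_choose_mul_factorial_mul_factorial t i]
    push_cast [← Nat.choose_symm_add (a := t) (b := i)]
    push_cast at h3
    linear_combination -((t + i).choose t * t.factorial * (t + i + d).choose t : ℂ) * h3
  rw [hcp]
  have hs : ((-1 : ℂ) ^ (t + i + d)) * (-1) ^ (t + i + d) = 1 := by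
    rw [← mul_pow]; simp
  have ht2 : ((-1 : ℂ) ^ t) * (-1) ^ t = 1 := by
    rw [← mul_pow]; simp
  clear_value b p e
  rw [neg_pow b, neg_pow (e * b * z), mul_pow b p, mul_pow (e * b) z, mul_pow e b,
    mul_pow (e * w) p, mul_pow e w, pow_add b, pow_add e, pow_add p, pow_add (-1) t i]
  set A := (-1) ^ i * (t + i + d).choose (t + i) * p ^ (-(c + 2 * ((t + i + d : ℕ) : ℂ))) *
    b ^ t * b ^ i * e ^ i * e ^ d * z ^ i * w ^ d * p ^ t * p ^ d with hA
  set K := (t + i).choose t * ((t + i + d).descFactorial t *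
        (ascPochhammer ℂ (i + d)).eval (c + ((t + i : ℕ) : ℂ))) /
        (ascPochhammer ℂ (t + i + d)).eval c with hK
  linear_combination A * K * hs - A * K * ht2 - A * (-1) ^ t * (-1) ^ t * hcoef

/-! ### Reduction of the basis functions to the Jacobi factor -/

theorem ofReal_Gamma_add_natCast {c : ℝ} (hc : 0 < c) (k : ℕ) :
    ((Real.Gamma (c + k) : ℝ) : ℂ) = (ascPochhammer ℂ k).eval (c : ℂ) * (Real.Gamma c : ℂ) := by
  induction k with
  | zero => simp
  | succ k ih =>
    have h : c + ((k + 1 : ℕ) : ℝ) = (c + k) + 1 := by push_cast; ring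
    rw [h, Real.Gamma_add_one (by positivity), Complex.ofReal_mul, ih, ascPochhammer_succ_eval]
    push_cast
    ring

theorem ascPochhammer_eval_ofReal_ne_zero {c : ℝ} (hc : 0 < c) (k : ℕ) :
    (ascPochhammer ℂ k).eval (c : ℂ) ≠ 0 := by
  intro h
  have h1 := ofReal_Gamma_add_natCast hc k
  rw [h, zero_mul, Complex.ofReal_eq_zero] at h1
  exact (Real.Gamma_pos_of_pos (by positivity)).ne' h1

theorem conj_jacobiFactor (c : ℝ) (m k : ℕ) (z z' : ℂ) :
    conj (jacobiFactor c m k z z') = jacobiFactor c m k (conj z) (conj z') := by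
  simp [jacobiFactor, Ring.map_multichoose (starRingEnd ℂ)]

theorem zpow_mul_pow_eq {z : ℂ} {m k j : ℕ} (hjm : j ≤ m) (hjk : j ≤ k) :
    conj z ^ ((m : ℤ) - k) * (z * conj z) ^ (k - j) = conj z ^ (m - j) * z ^ (k - j) := by
  -- At z = 0 a negative exponent m - k forces j < k, and then both sides contain a vanishing power.
  by_cases hz : z = 0
  · rcases eq_or_lt_of_le hjk with rfl | h
    · rw [← Nat.cast_sub hjm, zpow_natCast]
      simp
    · simp [hz, show k - j ≠ 0 by omega]
  · have hz' : conj z ≠ 0 := by simpa using hz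
    rw [mul_pow, mul_left_comm, ← zpow_natCast (conj z) (k - j), ← zpow_add₀ hz',
      ← zpow_natCast (conj z) (m - j), mul_comm, Nat.cast_sub hjm, Nat.cast_sub hjk]
    ring_nf

theorem ofReal_jacobiP (σ : ℝ) (m k : ℕ) (z : ℂ) :
    (jacobiP k ((m : ℝ) - k) (σ - 2 * m - 1) (1 - 2 * ‖z‖ ^ 2) : ℂ) =
      ∑ j ∈ range (k + 1), m.choose j * Ring.multichoose (((σ - 2 * m : ℝ) : ℂ) + j) (k - j) *
        (-(z * conj z)) ^ (k - j) * (1 - z * conj z) ^ j := by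
  have hr : z * conj z = ((‖z‖ ^ 2 : ℝ) : ℂ) := by rw [Complex.mul_conj']; simp
  rw [hr, jacobiP, ← sum_range_reflect]
  push_cast
  refine sum_congr rfl fun j hj => ?_
  have hj : j ≤ k := Nat.lt_succ_iff.mp (mem_range.mp hj)
  rw [show k - (k - j) = j by omega,
    show (k : ℂ) + (m - k) = m by ring, Ring.choose_natCast, Ring.multichoose_eq,
    Nat.cast_sub hj]
  congr 3
  · congr 2; ring
  · ring
  · ring

theorem basisFun_eq (σ : ℝ) (m k : ℕ) (z : ℂ) :
    basisFun σ m k z =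
      (Real.sqrt ((σ - 2 * m - 1) * Real.Gamma (σ - m) * (k.factorial : ℝ) /
        (Real.pi * (m.factorial : ℝ) * Real.Gamma (σ - 2 * m + k))) : ℂ) *
      (((1 - z * conj z) ^ m)⁻¹ * jacobiFactor ((σ - 2 * m : ℝ) : ℂ) m k z (conj z)) := by
  rw [basisFun, ofReal_jacobiP, mul_assoc]
  congr 1
  rw [div_eq_mul_inv, mul_comm ((-1) ^ k * _), mul_assoc]
  congr 1
  rw [jacobiFactor, mul_sum]
  refine sum_congr rfl fun j hj => ?_
  have hj : j ≤ k := Nat.lt_succ_iff.mp (mem_range.mp hj)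
  rcases Nat.lt_or_ge m j with hm | hm
  · simp [Nat.choose_eq_zero_of_lt hm]
  · have hs : (-1 : ℂ) ^ k * (-1) ^ (k - j) = (-1) ^ j := by
      rw [← pow_add, show k + (k - j) = 2 * (k - j) + j by omega, pow_add, pow_mul]
      simp
    rw [neg_pow (z * conj z), neg_pow (1 - z * conj z)]
    linear_combination m.choose j * Ring.multichoose (((σ - 2 * m : ℝ) : ℂ) + j) (k - j) *
      (1 - z * conj z) ^ j * ((-1) ^ k * (-1) ^ (k - j) * zpow_mul_pow_eq (z := z) hm hj +
        conj z ^ (m - j) * z ^ (k - j) * hs)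

/-! ### The kernel in hypergeometric form -/

/-- The terminating hypergeometric function as a finite sum. -/
theorem ordinaryHypergeometric_neg_natCast {c : ℂ} (hc : ∀ n, (ascPochhammer ℂ n).eval c ≠ 0)
    (m : ℕ) (x : ℂ) :
    ordinaryHypergeometric (-(m : ℂ)) (c + m) c x =
      ((ascPochhammer ℂ m).eval c)⁻¹ * ∑ n ∈ range (m + 1),
        (-1) ^ n * m.choose n * (ascPochhammer ℂ m).eval (c + n) * x ^ n := by
  have hn : ∀ n : ℕ, (ascPochhammer ℂ n).eval (-(m : ℂ)) =
      (-1) ^ n * (n.factorial * m.choose n) := by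
    intro n
    rw [ascPochhammer_eval_neg_eq_descPochhammer, descPochhammer_eval_eq_descFactorial,
      Nat.descFactorial_eq_factorial_mul_choose, Nat.cast_mul]
  simp only [ordinaryHypergeometric_eq_tsum]
  rw [tsum_eq_sum (s := range (m + 1)), mul_sum]
  · refine sum_congr rfl fun n _ => ?_
    have h1 := ascPochhammer_eval_add c m n
    rw [add_comm m n, ascPochhammer_eval_add c n m] at h1
    have hf : (n.factorial : ℂ) ≠ 0 := by exact_mod_cast n.factorial_ne_zero
    have hcn := hc n
    have hcm := hc m
    rw [hn, smul_eq_mul]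
    field_simp
    linear_combination -(m.choose n * x ^ n : ℂ) * h1
  · intro n hn'
    rw [hn, Nat.choose_eq_zero_of_lt (by simpa using hn')]
    simp

theorem one_sub_mul_ne_zero {x : ℂ} (h : ‖x‖ < 1) : 1 - x ≠ 0 := by
  intro h0
  rw [← sub_eq_zero.mp h0] at h
  simp at h

theorem norm_mul_lt_one {z w : ℂ} (hz : ‖z‖ < 1) (hw : ‖w‖ < 1) : ‖z * w‖ < 1 := by
  rw [norm_mul]
  exact mul_lt_one_of_nonneg_of_lt_one_left (norm_nonneg _) hz hw.le

/-- The reproducing kernel of the generalized Bergman space. -/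
noncomputable def kernel (σ : ℝ) (m : ℕ) (z w : ℂ) : ℂ :=
  (((σ - 2 * m - 1) * Real.Gamma (σ - m) : ℝ) : ℂ) /
    (((Real.pi * (m.factorial : ℝ) * (-1) ^ m * Real.Gamma (σ - 2 * m) : ℝ) : ℂ) *
      (1 - z * conj w) ^ (σ : ℂ)) * bergmanCoshSq z w ^ m *
    ordinaryHypergeometric (-(m : ℂ)) ((σ - m : ℝ) : ℂ) ((σ - 2 * m : ℝ) : ℂ)
      (bergmanCoshSq z w)⁻¹

theorem bergmanCoshSq_pow_mul_ordinaryHypergeometric {c : ℂ}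
    (hc : ∀ n, (ascPochhammer ℂ n).eval c ≠ 0) (m : ℕ) {z w : ℂ} (hz : ‖z‖ < 1) (hw : ‖w‖ < 1) :
    bergmanCoshSq z w ^ m * ordinaryHypergeometric (-(m : ℂ)) (c + m) c (bergmanCoshSq z w)⁻¹ =
      ((1 - z * conj z) ^ m)⁻¹ * ((1 - w * conj w) ^ m)⁻¹ * ((ascPochhammer ℂ m).eval c)⁻¹ *
        ∑ n ∈ range (m + 1), (-1) ^ n * m.choose n * (ascPochhammer ℂ m).eval (c + n) *
          ((1 - z * conj z) * (1 - w * conj w)) ^ n *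
            ((1 - z * conj w) * (1 - conj z * w)) ^ (m - n) := by
  have hz' : ‖conj z‖ < 1 := by simpa using hz
  have hw' : ‖conj w‖ < 1 := by simpa using hw
  have hab : (1 - z * conj z) * (1 - w * conj w) ≠ 0 :=
    mul_ne_zero (one_sub_mul_ne_zero (norm_mul_lt_one hz hz'))
      (one_sub_mul_ne_zero (norm_mul_lt_one hw hw'))
  have hpq : (1 - z * conj w) * (1 - conj z * w) ≠ 0 :=
    mul_ne_zero (one_sub_mul_ne_zero (norm_mul_lt_one hz hw'))
      (one_sub_mul_ne_zero (norm_mul_lt_one hz' hw))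
  rw [ordinaryHypergeometric_neg_natCast hc, bergmanCoshSq, ← mul_inv, ← mul_pow, mul_sum, mul_sum,
    mul_sum]
  set u := (1 - z * conj z) * (1 - w * conj w)
  set v := (1 - z * conj w) * (1 - conj z * w)
  refine sum_congr rfl fun n hn => ?_
  have hn : n ≤ m := Nat.lt_succ_iff.mp (mem_range.mp hn)
  have h : (v / u) ^ m * (v / u)⁻¹ ^ n = (u ^ m)⁻¹ * (u ^ n * v ^ (m - n)) := by
    obtain ⟨d, rfl⟩ := Nat.exists_eq_add_of_le hn
    rw [Nat.add_sub_cancel_left, inv_div, div_pow, div_pow, pow_add, pow_add]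
    field_simp
  linear_combination ((ascPochhammer ℂ m).eval c)⁻¹ * (-1) ^ n * m.choose n *
    (ascPochhammer ℂ m).eval (c + n) * h

theorem hasSum_basisFun_mul_conj {σ : ℝ} {m : ℕ} (hm : (m : ℝ) < (σ - 1) / 2) {z w : ℂ}
    (hz : ‖z‖ < 1) (hw : ‖w‖ < 1) :
    HasSum (fun k : ℕ => basisFun σ m k z * conj (basisFun σ m k w)) (kernel σ m z w) := by
  have hc : 0 < σ - 2 * m := by linarith
  have hp := ascPochhammer_eval_ofReal_ne_zero hc

  have hm0 : (0 : ℝ) ≤ m := m.cast_nonneg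
  have hw' : ‖conj w‖ < 1 := by simpa using hw
  have h := (hasSum_jacobiFactor hp m (conj z) w (norm_mul_lt_one hz hw')).mul_left
    ((((σ - 2 * m - 1) * Real.Gamma (σ - m) / (Real.pi * m.factorial * Real.Gamma (σ - 2 * m)) : ℝ)
      : ℂ) * (((1 - z * conj z) ^ m)⁻¹ * ((1 - w * conj w) ^ m)⁻¹))
  convert! h using 1
  · funext k
    have hs : ((Real.sqrt ((σ - 2 * m - 1) * Real.Gamma (σ - m) * (k.factorial : ℝ) /
        (Real.pi * (m.factorial : ℝ) * Real.Gamma (σ - 2 * m + k))) : ℝ) : ℂ) *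
        (Real.sqrt ((σ - 2 * m - 1) * Real.Gamma (σ - m) * (k.factorial : ℝ) /
        (Real.pi * (m.factorial : ℝ) * Real.Gamma (σ - 2 * m + k))) : ℝ) =
        (((σ - 2 * m - 1) * Real.Gamma (σ - m) /
          (Real.pi * m.factorial * Real.Gamma (σ - 2 * m)) : ℝ) : ℂ) *
        (k.factorial / (ascPochhammer ℂ k).eval ((σ - 2 * m : ℝ) : ℂ)) := by
      have h1 : 0 < Real.Gamma (σ - m) := Real.Gamma_pos_of_pos (by linarith)
      have h2 : 0 < Real.Gamma (σ - 2 * m + k) := Real.Gamma_pos_of_pos (by positivity)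
      have h3 : 0 < σ - 2 * m - 1 := by linarith
      rw [← Complex.ofReal_mul, Real.mul_self_sqrt (by positivity)]
      simp only [Complex.ofReal_div, Complex.ofReal_mul, ofReal_Gamma_add_natCast hc k,
        Complex.ofReal_natCast]
      ring
    rw [basisFun_eq, basisFun_eq, map_mul, map_mul, conj_jacobiFactor, map_inv₀, map_pow,
      map_sub, map_mul, Complex.conj_conj, map_one, Complex.conj_ofReal, mul_comm (conj w) w]
    linear_combination ((1 - z * conj z) ^ m)⁻¹ * ((1 - w * conj w) ^ m)⁻¹ *
      jacobiFactor ((σ - 2 * m : ℝ) : ℂ) m k z (conj z) *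
      jacobiFactor ((σ - 2 * m : ℝ) : ℂ) m k (conj w) w * hs
  · have h1 := bergmanCoshSq_pow_mul_ordinaryHypergeometric hp m hz hw
    have hsm : ((σ - m : ℝ) : ℂ) = ((σ - 2 * m : ℝ) : ℂ) + m := by push_cast; ring
    have hσ' : -(((σ - 2 * m : ℝ) : ℂ) + 2 * m) = -(σ : ℂ) := by push_cast; ring
    rw [kernel, hsm, mul_assoc, h1, hσ', Complex.cpow_neg]
    have hsgn : ((-1 : ℂ) ^ m)⁻¹ = (-1) ^ m := by rw [← inv_pow]; simp
    simp only [Complex.ofReal_mul, Complex.ofReal_pow, Complex.ofReal_neg,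
      Complex.ofReal_one, Complex.ofReal_inv, div_eq_mul_inv, mul_inv, hsgn]
    ring

theorem kernel_self_ne_zero {σ : ℝ} {m : ℕ} (hm : (m : ℝ) < (σ - 1) / 2) {z : ℂ}
    (hz : ‖z‖ < 1) : kernel σ m z z ≠ 0 := by
  have hc : 0 < σ - 2 * m := by linarith
  have hp := ascPochhammer_eval_ofReal_ne_zero hc
  have hm0 : (0 : ℝ) ≤ m := m.cast_nonneg
  have hz' : ‖conj z‖ < 1 := by simpa using hz
  have ha := one_sub_mul_ne_zero (norm_mul_lt_one hz hz')
  have hsm : ((σ - m : ℝ) : ℂ) = ((σ - 2 * m : ℝ) : ℂ) + m := by push_cast; ring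
  rw [kernel, mul_assoc, hsm, bergmanCoshSq_pow_mul_ordinaryHypergeometric hp m hz hz,
    mul_comm (conj z) z]
  have h1 := Real.Gamma_pos_of_pos (show 0 < σ - m by linarith)
  have h2 := Real.Gamma_pos_of_pos hc
  have h3 : σ - 2 * m - 1 ≠ 0 := by linarith
  refine mul_ne_zero (div_ne_zero ?_ (mul_ne_zero ?_ ?_)) (mul_ne_zero ?_ ?_)
  · exact_mod_cast mul_ne_zero h3 h1.ne'
  · have : Real.pi * (m.factorial : ℝ) * (-1) ^ m * Real.Gamma (σ - 2 * m) ≠ 0 := by positivity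
    exact_mod_cast this
  · rw [Ne, Complex.cpow_eq_zero_iff]
    exact fun h => ha h.1
  · have := hp m
    positivity
  -- On the diagonal, x = (1 - |z|²)² and y = u = 0 make the sum the functional at (-x)^m (X - 1)^m,
  -- which is (-x)^m m!.
  · have h4 := risingMoment_trinomial_left ((σ - 2 * m : ℝ) : ℂ)
      ((1 - z * conj z) * (1 - z * conj z)) 0 0 m
    simp only [sub_zero] at h4
    rw [← h4, show (Polynomial.C (-((1 - z * conj z) * (1 - z * conj z))) * Polynomial.X +
        Polynomial.C ((1 - z * conj z) * (1 - z * conj z))) =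
        Polynomial.C (-((1 - z * conj z) * (1 - z * conj z))) * (Polynomial.X - 1) by
      rw [Polynomial.C_neg]; ring, mul_pow, ← Polynomial.C_pow, risingMoment_C_mul]
    have h5 := risingMoment_sub_one_pow_mul ((σ - 2 * m : ℝ) : ℂ) m m 0
    rw [pow_zero, mul_one] at h5
    rw [h5]
    have := m.factorial_ne_zero
    simp only [Nat.descFactorial_self, Nat.sub_self, ascPochhammer_zero, Polynomial.eval_one, mul_one]
    exact mul_ne_zero (pow_ne_zero _ (neg_ne_zero.mpr (mul_ne_zero ha ha))) (by exact_mod_cast this)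

theorem hasSum_norm_basisFun_sq {σ : ℝ} {m : ℕ} (hm : (m : ℝ) < (σ - 1) / 2) {z : ℂ}
    (hz : ‖z‖ < 1) :
    HasSum (fun k : ℕ => ‖basisFun σ m k z‖ ^ 2) (normFactor σ m z) := by
  have h := Complex.hasSum_re (hasSum_basisFun_mul_conj hm hz hz)
  refine Summable.hasSum (h.summable.congr fun k => ?_)
  rw [Complex.mul_conj']
  norm_cast

theorem kernel_self {σ : ℝ} {m : ℕ} (hm : (m : ℝ) < (σ - 1) / 2) {z : ℂ}
    (hz : ‖z‖ < 1) : kernel σ m z z = (normFactor σ m z : ℂ) := by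
  refine (hasSum_basisFun_mul_conj hm hz hz).unique ?_
  convert! Complex.hasSum_ofReal.mpr (hasSum_norm_basisFun_sq hm hz) using 2
  rw [Complex.mul_conj']
  norm_cast

theorem normFactor_pos {σ : ℝ} {m : ℕ} (hm : (m : ℝ) < (σ - 1) / 2) {z : ℂ}
    (hz : ‖z‖ < 1) : 0 < normFactor σ m z := by
  refine lt_of_le_of_ne (tsum_nonneg fun k => by positivity) fun h => ?_
  exact kernel_self_ne_zero hm hz (by rw [kernel_self hm hz, ← h]; simp)

/-! ### Passage to the Hilbert space -/

theorem summable_smul_of_orthonormal {H : Type*} [NormedAddCommGroup H] [InnerProductSpace ℂ H]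
    [CompleteSpace H] {ψ : ℕ → H} (hψ : Orthonormal ℂ ψ) {f : ℕ → ℂ}
    (hf : Summable fun k => ‖f k‖ ^ 2) : Summable fun k => f k • ψ k := by
  have := (hψ.orthogonalFamily.summable_iff_norm_sq_summable f).mpr hf
  simpa using this

theorem hasSum_inner_of_orthonormal {H : Type*} [NormedAddCommGroup H] [InnerProductSpace ℂ H]
    {ψ : ℕ → H} (hψ : Orthonormal ℂ ψ) {f g : ℕ → ℂ}
    (hf : Summable fun k => f k • ψ k) (hg : Summable fun k => g k • ψ k) :
    HasSum (fun k => conj (f k) * g k) (inner ℂ (∑' k, f k • ψ k) (∑' k, g k • ψ k)) := by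
  have hcoef : ∀ k, inner ℂ (∑' j, f j • ψ j) (ψ k) = conj (f k) := by
    intro k
    have h := (hf.hasSum.mapL (innerSL ℂ (ψ k))).unique
      (hasSum_single k fun j hj => by
        simp [hψ.2 hj.symm])
    simp only [innerSL_apply_apply, inner_smul_right] at h
    rw [← inner_conj_symm, h, inner_self_eq_norm_sq_to_K, hψ.1 k]
    simp
  have h := hg.hasSum.mapL (innerSL ℂ (∑' k, f k • ψ k))
  convert! h using 2 with k
  simp [hcoef, mul_comm]

theorem inner_coherentState {H : Type*} [NormedAddCommGroup H] [InnerProductSpace ℂ H]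
    [CompleteSpace H] {ψ : ℕ → H} (hψ : Orthonormal ℂ ψ) {σ : ℝ} {m : ℕ}
    (hm : (m : ℝ) < (σ - 1) / 2) {z w : ℂ} (hz : ‖z‖ < 1) (hw : ‖w‖ < 1) :
    inner ℂ (coherentState ψ σ m z) (coherentState ψ σ m w) =
      (((normFactor σ m z * normFactor σ m w) ^ (-(1 / 2) : ℝ) : ℝ) : ℂ) * kernel σ m z w := by
  have hs : ∀ {z : ℂ}, ‖z‖ < 1 → Summable fun k => conj (basisFun σ m k z) • ψ k := fun hz =>
    summable_smul_of_orthonormal hψ (by simpa using (hasSum_norm_basisFun_sq hm hz).summable)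
  have h := (hasSum_inner_of_orthonormal hψ (hs hz) (hs hw)).unique
    (by simpa using hasSum_basisFun_mul_conj hm hz hw)
  rw [coherentState, coherentState, inner_smul_left, inner_smul_right, h, Complex.conj_ofReal,
    Real.mul_rpow (normFactor_pos hm hz).le (normFactor_pos hm hw).le, Complex.ofReal_mul]
  ring

end DiskCoherentState

/-- The pairing `⟨w, σ, m | z, σ, m⟩` is the scalar product of `|w, σ, m⟩` and `|z, σ, m⟩` that is
linear in its first and antilinear in its second argument; `inner ℂ` is linear in its second
argument, whence the order below. The first part says that the states are well defined and that
`normFactor` normalizes them. -/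
theorem proposition3p1 {H : Type*} [NormedAddCommGroup H] [InnerProductSpace ℂ H]
    [CompleteSpace H] (ψ : ℕ → H) (hψ : Orthonormal ℂ ψ)
    (σ : ℝ) (hσ : 1 < σ) (m : ℕ) (hm : (m : ℝ) < (σ - 1) / 2) :
    (∀ z : ℂ, ‖z‖ < 1 →
      Summable (fun k : ℕ => ‖DiskCoherentState.basisFun σ m k z‖ ^ 2) ∧
      0 < DiskCoherentState.normFactor σ m z ∧
      Summable (fun k : ℕ => conj (DiskCoherentState.basisFun σ m k z) • ψ k) ∧
      ‖DiskCoherentState.coherentState ψ σ m z‖ = 1) ∧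
    ∀ z w : ℂ, ‖z‖ < 1 → ‖w‖ < 1 →
      inner ℂ (DiskCoherentState.coherentState ψ σ m z)
          (DiskCoherentState.coherentState ψ σ m w) =
        (((σ - 2 * m - 1) * Real.Gamma (σ - m) *
              (DiskCoherentState.normFactor σ m z *
                DiskCoherentState.normFactor σ m w) ^ (-(1 / 2) : ℝ) : ℝ) : ℂ) /
            (((Real.pi * (m.factorial : ℝ) * (-1) ^ m * Real.Gamma (σ - 2 * m) : ℝ) : ℂ) *
              (1 - z * conj w) ^ (σ : ℂ)) *
          DiskCoherentState.bergmanCoshSq z w ^ m *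
          ordinaryHypergeometric (-(m : ℂ)) ((σ - m : ℝ) : ℂ) ((σ - 2 * m : ℝ) : ℂ)
            (DiskCoherentState.bergmanCoshSq z w)⁻¹ := by
  open DiskCoherentState in
  refine ⟨fun z hz => ?_, fun z w hz hw => ?_⟩
  · have hN := hasSum_norm_basisFun_sq hm hz
    have hpos := normFactor_pos hm hz
    refine ⟨hN.summable, hpos, summable_smul_of_orthonormal hψ (by simpa using hN.summable), ?_⟩
    have h := inner_coherentState hψ hm hz hz
    have hsq : (normFactor σ m z * normFactor σ m z) ^ (-(1 / 2) : ℝ) * normFactor σ m z = 1 := by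
      rw [Real.rpow_neg (by positivity), ← Real.sqrt_eq_rpow, Real.sqrt_mul_self hpos.le,
        inv_mul_cancel₀ hpos.ne']
    rw [kernel_self hm hz, ← Complex.ofReal_mul, hsq, inner_self_eq_norm_sq_to_K] at h
    have h' : ‖coherentState ψ σ m z‖ ^ 2 = 1 := Complex.ofReal_injective (by simpa using h)
    exact (pow_eq_one_iff_of_nonneg (norm_nonneg _) two_ne_zero).mp h'
  · rw [inner_coherentState hψ hm hz hw, kernel, Complex.ofReal_mul _ (_ ^ (-(1 / 2) : ℝ))]
    ring
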